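/- A hypergraph $G=(V,E,\mathsf e)$ consists of a finite set $V$ of vertices, a finite set $E$ of edges and a map $\mathsf e:E\to 2^V$. A morphism $H\to G$ is an injective map $f:V(H)\to V(G)$ such that for every edge $e$ of $H$ there is an edge $e'$ of $G$ with $f(\mathsf e(e))=\mathsf e(e')$. For $p\subseteq V$, the restriction $G|_p$ has vertex set $p$ and those edges of $G$ all of whose vertices lie in $p$. A clustering scheme $\mathfrak C$ assigns to every hypergraph $G$ a set $\mathfrak C(G)\subseteq 2^{V(G)}$ of parts. It is *functorial* if for every morphism $f:H\to G$ and every $p\in\mathfrak C(H)$ there is $q\in\mathfrak C(G)$ with $f(p)\subseteq q$; it is *excisive* if $p\in\mathfrak C(G|_p)$ whenever $p\in\mathfrak C(G)$. For a (possibly infinite) set $\mathcal R$ of hypergraphs let $\Phi_{\mathcal R}(G)$ have the vertices of $G$, and as edges all morphisms $\omega:R\to G$ with $R\in\mathcal R$, the vertex set of the edge $\omega$ being its image. For $k\in\{1,2,\dots,\infty\}$ let $\Lambda_k(H)$ be the simple graph whose vertices are the vertex sets of the edges of $H$, two distinct ones being adjacent if they have at least $k$ common elements. Let $\Pi_{\mathcal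 R,k}(G)$ consist of the sets $\bigcup_{a\in c}a$, where $c$ runs over the connected components of $\Lambda_k(\Phi_{\mathcal R}(G))$. A clustering scheme is *representable* if it is equal to $\Pi_{\mathcal R,k}$ for some such $\mathcal R$ and $k$. Let $D$ be the hypergraph with vertices $0,1,2,3,4,5$ and the three edges $\{0,3,4\}$, $\{1,4,5\}$, $\{2,3,5\}$. The vertices of $\Lambda_3(\Phi_{\{D\}}(G))$ are the vertex sets of the copies of $D$ in $G$ (the images of the morphisms $D\to G$). The labels of such a set $a$ are the vertex sets of the three edges of $G$ that are the images of the edges of $D$ under a morphism $D\to G$ with image $a$ (for all such morphisms). Let $\Sigma(G)$ be the graph obtained from $\Lambda_3(\Phi_{\{D\}}(G))$ by keeping an edge if and only if its two ends share a label, and let $\mathfrak C(G)$ consist of the sets $\bigcup_{a\in c}a$, where $c$ runs over the connected components of $\Sigma(G)$. **Lemma.** The clustering scheme $\mathfrak C$ is excisive and functorial, and it is not equal to any representable clustering scheme. In particular there is an excisive and functorial clustering scheme that is not equal to any representable one. -/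

import Mathlib

set_option linter.checkUnivs false

universe u v u' v'

namespace OverlapClust

/-- A hypergraph `(V, E, ea)`: `ea` assigns to every edge its vertex set, so parallel edges are
allowed. Finiteness is imposed in `FinHypergraph`. -/
structure Hypergraph where
  V : Type u
  E : Type v
  ea : E → Set V

/-- The objects of the category of hypergraphs: finitely many vertices and edges. -/
structure FinHypergraph extends Hypergraph.{0, 0} where
  finiteV : Finite V
  finiteE : Finite E

/-- A morphism of hypergraphs: an injective map of vertices such that the image of the vertex set
of any edge is the vertex set of some edge. -/
structure Hom (H : Hypergraph.{u, v}) (G : Hypergraph.{u', v'}) where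
  toFun : H.V → G.V
  injective : Function.Injective toFun
  map_edge : ∀ e : H.E, ∃ e' : G.E, toFun '' H.ea e = G.ea e'

/-- The restriction `G|_p`: its vertex set is `p`, its edges are the edges of `G` all of whose
vertices lie in `p`. -/
abbrev FinHypergraph.restrict (G : FinHypergraph) (p : Set G.V) : FinHypergraph where
  V := p
  E := {e : G.E // G.ea e ⊆ p}
  ea e := Subtype.val ⁻¹' G.ea e.1
  finiteV := by have := G.finiteV; exact inferInstance
  finiteE := by have := G.finiteE; exact inferInstance

/-- `f : (V, P) → (W, Q)` is a morphism of sets with overlapping partitions: the image of each part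
is contained in some part. -/
def IsPartMorphism {V : Type u} {W : Type u'} (P : Set (Set V)) (Q : Set (Set W))
    (f : V → W) : Prop :=
  ∀ p ∈ P, ∃ q ∈ Q, f '' p ⊆ q

/-- A clustering scheme sends every finite hypergraph to a set of parts on its own vertex set. -/
abbrev ClusteringScheme : Type 1 := (G : FinHypergraph) → Set (Set G.V)

/-- `C` is functorial: setting `C(f) = f` on underlying functions, `C` sends morphisms to
morphisms. (Identities and composites are then preserved automatically.) -/
def ClusteringScheme.IsFunctorial (C : ClusteringScheme) : Prop :=
  ∀ (H G : FinHypergraph) (f : Hom H.toHypergraph G.toHypergraph),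
    IsPartMorphism (C H) (C G) f.toFun

/-- `C` is excisive: each part `p` of `C(G)` is a part of `C(G|_p)`, that is, the whole vertex set
of `G|_p` is one of its parts. -/
def ClusteringScheme.IsExcisive (C : ClusteringScheme) : Prop :=
  ∀ (G : FinHypergraph), ∀ p ∈ C G, (Set.univ : Set (G.restrict p).V) ∈ C (G.restrict p)

/-- `Φ_R(G)`: the vertices are those of `G`, the edges are all morphisms from members of `R` to
`G`, and each such morphism has its image as vertex set. (For infinite `R` there may be infinitely
many edges, though only finitely many vertex sets of edges.) -/
abbrev representableEndo (R : Set FinHypergraph) (G : FinHypergraph) : Hypergraph.{0, 1} where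
  V := G.V
  E := Σ r : R, Hom r.1.toHypergraph G.toHypergraph
  ea w := Set.range w.2.toFun

/-- The `k`-line graph: its vertices are the vertex sets of the edges of `G`, and distinct ones are
adjacent when they share at least `k` elements. -/
def lineGraph (k : ℕ∞) (G : Hypergraph.{u, v}) : SimpleGraph (Set.range G.ea) where
  Adj a b := a ≠ b ∧ k ≤ (a.1 ∩ b.1).encard
  symm := ⟨fun _ _ h => ⟨h.1.symm, by rw [Set.inter_comm]; exact h.2⟩⟩
  loopless := ⟨fun _ h => h.1 rfl⟩

/-- For a graph `L` whose vertices are subsets of `V`: the unions of the members of each connected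
component of `L`. -/
def componentUnions {V : Type u} {S : Set (Set V)} (L : SimpleGraph S) : Set (Set V) :=
  Set.range fun c : L.ConnectedComponent => ⋃ a ∈ c.supp, (a : Set V)

/-- The parts of `Π_k(G)`, the `k`-ly connected components of `G`. -/
def connectedParts (k : ℕ∞) (G : Hypergraph.{u, v}) : Set (Set G.V) :=
  componentUnions (lineGraph k G)

/-- The scheme `Π_{R,k} = Π_k ∘ Φ_R`. -/
def representableScheme (R : Set FinHypergraph) (k : ℕ∞) : ClusteringScheme :=
  fun G => connectedParts k (representableEndo R G)

/-- `C` is equal to `Π_{R,k}` for some set `R` of hypergraphs and some `k ∈ {1, 2, …, ∞}`. -/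
def ClusteringScheme.IsRepresentable (C : ClusteringScheme) : Prop :=
  ∃ (R : Set FinHypergraph) (k : ℕ∞), 1 ≤ k ∧ C = representableScheme R k

/-- The hypergraph `D`: six vertices and three edges of size three, each two of which meet in
exactly one vertex; `3, 4, 5` are the pairwise intersections and `0, 1, 2` the corners. -/
def graphD : FinHypergraph where
  V := Fin 6
  E := Fin 3
  ea := ![{0, 3, 4}, {1, 4, 5}, {2, 3, 5}]
  finiteV := inferInstance
  finiteE := inferInstance

/-- The labels of a set `a` of vertices of `G`: the (vertex sets of the) three edges of `G` that
make up a copy of `D` in `G` with vertex set `a`. -/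
def copyLabels (G : FinHypergraph) (a : Set G.V) : Set (Set G.V) :=
  {l | ∃ w : Hom graphD.toHypergraph G.toHypergraph,
    Set.range w.toFun = a ∧ ∃ d : graphD.E, l = w.toFun '' graphD.ea d}

/-- The graph `Σ(G)`: keep an edge of the `3`-line graph of `Φ_{D}(G)` exactly when its two ends
share a label. -/
def labelledLineGraph (G : FinHypergraph) :
    SimpleGraph (Set.range (representableEndo {graphD} G).ea) where
  Adj a b := (lineGraph 3 (representableEndo {graphD} G)).Adj a b ∧
    (copyLabels G a.1 ∩ copyLabels G b.1).Nonempty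
  symm := ⟨fun _ _ h => ⟨h.1.symm, by rw [Set.inter_comm]; exact h.2⟩⟩
  loopless := ⟨fun _ h => h.1.ne rfl⟩

/-- The clustering scheme whose parts are the unions of the connected components of `Σ(G)`. -/
def gluedScheme : ClusteringScheme :=
  fun G => componentUnions (labelledLineGraph G)

end OverlapClust

namespace OverlapClust

/-! ### Components and unions -/

/-! A morphism of hypergraphs carries copies of `D` to copies, and preserves labels and the sizes of
intersections. It therefore induces a map of the graphs `Σ`, which gives functoriality. Copies
inside a part, and their adjacencies, survive restriction to that part, which gives excision.

Suppose the scheme were `Π_{R,k}`. Evaluating it on `D` shows that some member of `R` maps onto `D`,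
so every copy of `D` is a vertex of `Λ_k(Φ_R(G))` (`copy_mem_of_eq`). In `graphTwo`, two copies of
`D` share an edge, so neither is a part on its own. Hence copy `A` has a neighbour in
`Λ_k(Φ_R(graphTwo))`. That neighbour can only be `B` or the whole vertex set, so either `k ≤ |A ∩ B|
= 3`, or `k ≤ |A| = 6` and a member of `R` maps onto `graphTwo` (`le_three_or_exists_surjective`).

`graphFour` defeats both cases. Its two halves, each a `graphTwo`, meet in six vertices and contain
copies of `D` meeting in four, so either bound makes everything one part of `Π_{R,k}`. But the
halves have no edge in common and no copy of `D` mixes them, so no label joins them in `Σ`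
(`univ_notMem_gluedScheme_graphFour`). -/

theorem componentUnions_of_forall_reachable {V : Type*} {S : Set (Set V)} {L : SimpleGraph S}
    (x : S) (h : ∀ v, ∃ y : S, L.Reachable x y ∧ v ∈ (y : Set V)) :
    Set.univ ∈ componentUnions L := by
  refine ⟨L.connectedComponentMk x, Set.eq_univ_of_forall fun v => ?_⟩
  obtain ⟨y, hy, hv⟩ := h v
  simp only [Set.mem_iUnion]
  exact ⟨y, SimpleGraph.ConnectedComponent.sound hy.symm, hv⟩

/-- Used in contrapositive form: a vertex of the line graph that is not itself a part must have a
neighbour. -/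
theorem componentUnions_of_isolated {V : Type*} {S : Set (Set V)} {L : SimpleGraph S}
    (x : S) (h : ∀ y, ¬ L.Adj x y) : (x : Set V) ∈ componentUnions L := by
  have key : ∀ y, L.Reachable x y → y = x := by
    rintro y ⟨p⟩
    cases p with
    | nil => rfl
    | cons hadj _ => exact (h _ hadj).elim
  refine ⟨L.connectedComponentMk x, Set.Subset.antisymm ?_ ?_⟩
  · refine Set.iUnion₂_subset fun y hy => ?_
    rw [key y (SimpleGraph.ConnectedComponent.exact hy).symm]
  · exact Set.subset_iUnion₂_of_subset x rfl subset_rfl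

theorem exists_of_mem_componentUnions {V : Type*} {S : Set (Set V)} {L : SimpleGraph S}
    {p : Set V} (hp : p ∈ componentUnions L) :
    ∃ x : S, p = ⋃ y ∈ {y | L.Reachable x y}, (y : Set V) := by
  obtain ⟨c, rfl⟩ := hp
  induction c using SimpleGraph.ConnectedComponent.ind with
  | h x =>
    have h : (L.connectedComponentMk x).supp = {y | L.Reachable x y} := by
      ext y
      exact SimpleGraph.ConnectedComponent.eq.trans ⟨fun h => h.symm, fun h => h.symm⟩
    exact ⟨x, by simp only [h]⟩

/-! ### Morphisms and copies of `D` -/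

/-- Composition of morphisms of hypergraphs. -/
def Hom.comp {H G K : Hypergraph} (g : Hom G K) (f : Hom H G) : Hom H K where
  toFun := g.toFun ∘ f.toFun
  injective := g.injective.comp f.injective
  map_edge e := by
    obtain ⟨e', he'⟩ := f.map_edge e
    obtain ⟨e'', he''⟩ := g.map_edge e'
    exact ⟨e'', by rw [Set.image_comp, he', he'']⟩

theorem Hom.range_comp {H G K : Hypergraph} (g : Hom G K) (f : Hom H G) :
    Set.range (g.comp f).toFun = g.toFun '' Set.range f.toFun :=
  Set.range_comp g.toFun f.toFun

/-- The identity morphism. -/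
def Hom.id (G : Hypergraph) : Hom G G := ⟨_root_.id, Function.injective_id, fun e => ⟨e, by simp⟩⟩

theorem range_mem_representableEndo {R : Set FinHypergraph} {H G : FinHypergraph} (hH : H ∈ R)
    (w : Hom H.toHypergraph G.toHypergraph) :
    Set.range w.toFun ∈ Set.range (representableEndo R G).ea :=
  ⟨⟨⟨H, hH⟩, w⟩, rfl⟩

theorem exists_hom_of_mem {R : Set FinHypergraph} {G : FinHypergraph} {a : Set G.V}
    (ha : a ∈ Set.range (representableEndo R G).ea) :
    ∃ H ∈ R, ∃ w : Hom H.toHypergraph G.toHypergraph, Set.range w.toFun = a := by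
  obtain ⟨⟨⟨H, hH⟩, w⟩, rfl⟩ := ha
  exact ⟨H, hH, w, rfl⟩

theorem exists_copy_of_mem {G : FinHypergraph} {a : Set G.V}
    (ha : a ∈ Set.range (representableEndo {graphD} G).ea) :
    ∃ w : Hom graphD.toHypergraph G.toHypergraph, Set.range w.toFun = a := by
  obtain ⟨H, hH, w, hw⟩ := exists_hom_of_mem ha
  obtain rfl : H = graphD := hH
  exact ⟨w, hw⟩

theorem copy_mem {G : FinHypergraph} (w : Hom graphD.toHypergraph G.toHypergraph) :
    Set.range w.toFun ∈ Set.range (representableEndo {graphD} G).ea :=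
  range_mem_representableEndo (Set.mem_singleton _) w

/-! ### Functoriality -/

theorem image_copyLabels {H G : FinHypergraph} (f : Hom H.toHypergraph G.toHypergraph)
    {a l : Set H.V} (hl : l ∈ copyLabels H a) : f.toFun '' l ∈ copyLabels G (f.toFun '' a) := by
  obtain ⟨w, rfl, d, rfl⟩ := hl
  exact ⟨f.comp w, f.range_comp w, d, (Set.image_comp _ _ _).symm⟩

/-- The map of graphs `Σ(H) → Σ(G)` induced by a morphism `H → G`. -/
def labelledLineGraphHom {H G : FinHypergraph} (f : Hom H.toHypergraph G.toHypergraph) :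
    labelledLineGraph H →g labelledLineGraph G where
  toFun a := ⟨f.toFun '' a.1, by
    obtain ⟨w, hw⟩ := exists_copy_of_mem a.2
    rw [← hw, ← f.range_comp w]
    exact copy_mem _⟩
  map_rel' := by
    rintro a b ⟨⟨hne, hk⟩, l, hla, hlb⟩
    refine ⟨⟨fun h => hne ?_, ?_⟩, _, image_copyLabels f hla, image_copyLabels f hlb⟩
    · exact Subtype.ext (f.injective.image_injective (congrArg Subtype.val h))
    · change _ ≤ (f.toFun '' a.1 ∩ f.toFun '' b.1).encard
      rw [← Set.image_inter f.injective, f.injective.encard_image]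
      exact hk

theorem gluedScheme_isFunctorial : gluedScheme.IsFunctorial := by
  intro H G f p hp
  obtain ⟨x, rfl⟩ := exists_of_mem_componentUnions hp
  refine ⟨_, ⟨(labelledLineGraph G).connectedComponentMk (labelledLineGraphHom f x), rfl⟩, ?_⟩
  rw [Set.image_iUnion₂]
  refine Set.iUnion₂_subset fun y hy => ?_
  have hy' : (labelledLineGraph H).Reachable x y := hy
  exact Set.subset_iUnion₂_of_subset (labelledLineGraphHom f y)
    (SimpleGraph.ConnectedComponent.sound (hy'.map (labelledLineGraphHom f)).symm) subset_rfl

/-! ### Excision -/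

/-- A morphism with image in `p` factors through the restriction to `p`. -/
def Hom.corestrict {H G : FinHypergraph} (w : Hom H.toHypergraph G.toHypergraph) {p : Set G.V}
    (hp : Set.range w.toFun ⊆ p) : Hom H.toHypergraph (G.restrict p).toHypergraph where
  toFun v := ⟨w.toFun v, hp ⟨v, rfl⟩⟩
  injective v v' h := w.injective (congrArg Subtype.val h)
  map_edge e := by
    obtain ⟨e', he'⟩ := w.map_edge e
    refine ⟨⟨e', he' ▸ (Set.image_subset_range _ _).trans hp⟩, ?_⟩
    change _ = Subtype.val ⁻¹' G.ea e'
    rw [← he']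
    ext v
    simp [Subtype.ext_iff]

theorem Hom.corestrict_image {H G : FinHypergraph} (w : Hom H.toHypergraph G.toHypergraph)
    {p : Set G.V} (hp : Set.range w.toFun ⊆ p) (s : Set H.V) :
    (w.corestrict hp).toFun '' s = Subtype.val ⁻¹' (w.toFun '' s) := by
  ext v
  simp [Hom.corestrict, Subtype.ext_iff]

theorem Hom.range_corestrict {H G : FinHypergraph} (w : Hom H.toHypergraph G.toHypergraph)
    {p : Set G.V} (hp : Set.range w.toFun ⊆ p) :
    Set.range (w.corestrict hp).toFun = Subtype.val ⁻¹' Set.range w.toFun := by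
  rw [← Set.image_univ, w.corestrict_image hp, Set.image_univ]

theorem preimage_mem_restrict {G : FinHypergraph} {p a : Set G.V}
    (ha : a ∈ Set.range (representableEndo {graphD} G).ea) (hap : a ⊆ p) :
    (Subtype.val ⁻¹' a : Set p) ∈
      Set.range (representableEndo {graphD} (G.restrict p)).ea := by
  obtain ⟨w, rfl⟩ := exists_copy_of_mem ha
  exact w.range_corestrict hap ▸ copy_mem (w.corestrict hap)

theorem preimage_copyLabels {G : FinHypergraph} {p a l : Set G.V} (hap : a ⊆ p)
    (hl : l ∈ copyLabels G a) :
    (Subtype.val ⁻¹' l : Set p) ∈ copyLabels (G.restrict p) (Subtype.val ⁻¹' a) := by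
  obtain ⟨w, rfl, d, rfl⟩ := hl
  exact ⟨w.corestrict hap, w.range_corestrict hap, d, (w.corestrict_image hap _).symm⟩

theorem labelledLineGraph_restrict_adj {G : FinHypergraph} {p : Set G.V}
    {a b : Set.range (representableEndo {graphD} G).ea} (hap : a.1 ⊆ p) (hbp : b.1 ⊆ p)
    (h : (labelledLineGraph G).Adj a b) :
    (labelledLineGraph (G.restrict p)).Adj ⟨_, preimage_mem_restrict a.2 hap⟩
      ⟨_, preimage_mem_restrict b.2 hbp⟩ := by
  obtain ⟨⟨hne, hk⟩, l, hla, hlb⟩ := h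
  refine ⟨⟨fun h => hne (Subtype.ext ?_), ?_⟩, _, preimage_copyLabels hap hla,
    preimage_copyLabels hbp hlb⟩
  -- Both sets lie in `p`, so taking images under the inclusion recovers them from their traces on
  -- `p`.
  · have h' := congrArg (fun s => Subtype.val '' s.1) h
    simpa [Subtype.image_preimage_coe, Set.inter_eq_right.2 hap, Set.inter_eq_right.2 hbp] using h'
  · change _ ≤ ((Subtype.val ⁻¹' a.1 : Set p) ∩ Subtype.val ⁻¹' b.1).encard
    rw [← Set.preimage_inter, ← Subtype.val_injective.encard_image, Subtype.image_preimage_coe,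
      Set.inter_eq_right.2 (Set.inter_subset_left.trans hap)]
    exact hk

theorem gluedScheme_isExcisive : gluedScheme.IsExcisive := by
  intro G p hp
  obtain ⟨x, hx⟩ := exists_of_mem_componentUnions hp
  have hsub : ∀ y, (labelledLineGraph G).Reachable x y → y.1 ⊆ p := fun y hy =>
    hx ▸ Set.subset_iUnion₂_of_subset y hy subset_rfl
  have key : ∀ y (hy : (labelledLineGraph G).Reachable x y),
      (labelledLineGraph (G.restrict p)).Reachable ⟨_, preimage_mem_restrict x.2 (hsub x .rfl)⟩
        ⟨_, preimage_mem_restrict y.2 (hsub y hy)⟩ := by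
    -- Every copy along a walk from `x` lies in the same component, hence inside `p`, so the walk
    -- can be lifted edge by edge.
    intro y hy
    have hy' := (SimpleGraph.reachable_iff_reflTransGen _ _).1 hy
    induction hy' with
    | refl => exact .rfl
    | @tail b c hb hbc ih =>
      have hb' := (SimpleGraph.reachable_iff_reflTransGen _ _).2 hb
      exact (ih hb').trans (labelledLineGraph_restrict_adj (hsub b hb') (hsub c hy) hbc).reachable
  refine componentUnions_of_forall_reachable (L := labelledLineGraph (G.restrict p))
    ⟨_, preimage_mem_restrict x.2 (hsub x .rfl)⟩ fun v => ?_
  have hv : v.1 ∈ ⋃ y ∈ {y | (labelledLineGraph G).Reachable x y}, (y : Set G.V) := hx ▸ v.2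
  simp only [Set.mem_iUnion] at hv
  obtain ⟨y, hy, hv⟩ := hv
  exact ⟨_, key y hy, hv⟩

/-! ### Hypergraphs given by finite sets -/

/-- The hypergraph on `Fin n` with edges `F 0, …, F (m - 1)`. -/
def ofFinsets {n m : ℕ} (F : Fin m → Finset (Fin n)) : FinHypergraph where
  V := Fin n
  E := Fin m
  ea i := F i
  finiteV := inferInstance
  finiteE := inferInstance

/-- The edges of `D` as finite sets. -/
def edgesD : Fin 3 → Finset (Fin 6) := ![{0, 3, 4}, {1, 4, 5}, {2, 3, 5}]

theorem graphD_ea (d : Fin 3) : graphD.ea d = (edgesD d : Set (Fin 6)) := by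
  fin_cases d <;> simp [graphD, edgesD]

/-- A morphism of hypergraphs given by finite sets. -/
def homOfFinsets {n m n' m' : ℕ} {F : Fin m → Finset (Fin n)} {F' : Fin m' → Finset (Fin n')}
    (f : Fin n → Fin n') (hf : Function.Injective f) (h : ∀ i, ∃ j, (F i).image f = F' j) :
    Hom (ofFinsets F).toHypergraph (ofFinsets F').toHypergraph where
  toFun := f
  injective := hf
  map_edge i := by
    obtain ⟨j, hj⟩ := h i
    refine ⟨j, ?_⟩
    change f '' (F i : Set (Fin n)) = (F' j : Set (Fin n'))
    rw [← hj, Finset.coe_image]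

/-- A copy of `D` in a hypergraph given by finite sets. -/
def copyOfFinsets {n m : ℕ} {F : Fin m → Finset (Fin n)}
    (f : Fin 6 → Fin n) (hf : Function.Injective f) (h : ∀ i, ∃ j, (edgesD i).image f = F j) :
    Hom graphD.toHypergraph (ofFinsets F).toHypergraph where
  toFun := f
  injective := hf
  map_edge i := by
    obtain ⟨j, hj⟩ := h i
    refine ⟨j, ?_⟩
    have hi : f '' (edgesD i : Set (Fin 6)) = (F j : Set (Fin n)) := by
      rw [← hj, Finset.coe_image]
    exact (congrArg (fun s => f '' s) (graphD_ea i)).trans hi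

/-- The edges `i`, `j`, `k` form a triangle: they pairwise meet in one vertex, and no vertex lies
on all three of them. -/
def IsTriangle {n m : ℕ} (F : Fin m → Finset (Fin n)) (i j k : Fin m) : Prop :=
  (F i ∩ F j).card = 1 ∧ (F i ∩ F k).card = 1 ∧ (F j ∩ F k).card = 1 ∧ F i ∩ F j ∩ F k = ∅

instance {n m : ℕ} (F : Fin m → Finset (Fin n)) (i j k : Fin m) :
    Decidable (IsTriangle F i j k) := by
  unfold IsTriangle
  infer_instance

/-- Replaces the enumeration of injections from six vertices by that of triples of edges, which
`decide` can check. -/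
theorem exists_triangle {n m : ℕ} {F : Fin m → Finset (Fin n)}
    (w : Hom graphD.toHypergraph (ofFinsets F).toHypergraph) :
    ∃ t : Fin 3 → Fin m, (∀ d, w.toFun '' graphD.ea d = (F (t d) : Set (Fin n))) ∧
      IsTriangle F (t 0) (t 1) (t 2) ∧
      Set.range w.toFun = ((F (t 0) ∪ F (t 1) ∪ F (t 2) : Finset (Fin n)) : Set (Fin n)) := by
  choose t ht using w.map_edge
  let f : Fin 6 → Fin n := w.toFun
  have hf : Function.Injective f := w.injective
  have hF : ∀ d : Fin 3, F (t d) = (edgesD d).image f := by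
    intro d
    have h : f '' graphD.ea d = (F (t d) : Set (Fin n)) := ht d
    rw [graphD_ea] at h
    exact_mod_cast h.symm
  have hinter : ∀ d d' : Fin 3, F (t d) ∩ F (t d') = (edgesD d ∩ edgesD d').image f := by
    intro d d'
    rw [hF, hF, Finset.image_inter _ _ hf]
  refine ⟨t, ht, ⟨?_, ?_, ?_, ?_⟩, ?_⟩
  · rw [hinter 0 1, Finset.card_image_of_injective _ hf]; decide
  · rw [hinter 0 2, Finset.card_image_of_injective _ hf]; decide
  · rw [hinter 1 2, Finset.card_image_of_injective _ hf]; decide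
  · rw [hinter 0 1, hF 2, ← Finset.image_inter _ _ hf, Finset.image_eq_empty]; decide
  · change Set.range f = _
    rw [hF 0, hF 1, hF 2, ← Finset.image_union, ← Finset.image_union,
      show edgesD 0 ∪ edgesD 1 ∪ edgesD 2 = Finset.univ by decide, Finset.coe_image,
      Finset.coe_univ, Set.image_univ]

theorem range_eq_coe {N n : ℕ} {f : Fin N → Fin n} {s : Finset (Fin n)}
    (h : Finset.univ.image f = s) : Set.range f = (s : Set (Fin n)) := by
  rw [← h, Finset.coe_image, Finset.coe_univ, Set.image_univ]

theorem coe_mem_of_range_mem {N n : ℕ} {S : Set (Set (Fin n))} {f : Fin N → Fin n}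
    {s : Finset (Fin n)} (hf : Set.range f ∈ S) (h : Finset.univ.image f = s) :
    (s : Set (Fin n)) ∈ S :=
  range_eq_coe h ▸ hf

theorem le_encard_coe_inter {n : ℕ} {k : ℕ∞} {N : ℕ} (hk : k ≤ N) {s t : Finset (Fin n)}
    (h : N ≤ (s ∩ t).card) : k ≤ ((s : Set (Fin n)) ∩ t).encard := by
  rw [← Finset.coe_inter, Set.encard_coe_eq_coe_finsetCard]
  exact hk.trans (by exact_mod_cast h)

theorem le_of_le_encard_coe_inter {n : ℕ} {k : ℕ∞} {N : ℕ} {s t : Finset (Fin n)}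
    (hk : k ≤ ((s : Set (Fin n)) ∩ t).encard) (h : (s ∩ t).card ≤ N) : k ≤ N := by
  rw [← Finset.coe_inter, Set.encard_coe_eq_coe_finsetCard] at hk
  exact hk.trans (by exact_mod_cast h)

/-! ### Two copies of `D` sharing an edge -/

/-- The edges of two copies of `D` that share the edge `{0, 3, 4}`. -/
def edgesTwo : Fin 5 → Finset (Fin 9) :=
  ![{0, 3, 4}, {1, 4, 5}, {2, 3, 5}, {4, 6, 7}, {3, 6, 8}]

/-- Two copies of `D` sharing an edge. -/
abbrev graphTwo : FinHypergraph := ofFinsets edgesTwo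

/-- The vertices of the first copy of `D`. -/
def copyA : Finset (Fin 9) := {0, 1, 2, 3, 4, 5}

/-- The vertices of the second copy of `D`. -/
def copyB : Finset (Fin 9) := {0, 3, 4, 6, 7, 8}

/-- The first copy of `D`. -/
def homA : Hom graphD.toHypergraph graphTwo.toHypergraph :=
  copyOfFinsets ![0, 1, 2, 3, 4, 5] (by decide) (by decide)

/-- The second copy of `D`. -/
def homB : Hom graphD.toHypergraph graphTwo.toHypergraph :=
  -- The vertices `0`, `3`, `4` of the shared edge are fixed.
  copyOfFinsets ![0, 7, 8, 3, 4, 6] (by decide) (by decide)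

theorem range_homA : Set.range homA.toFun = (copyA : Set (Fin 9)) :=
  range_eq_coe (by decide)

theorem range_homB : Set.range homB.toFun = (copyB : Set (Fin 9)) :=
  range_eq_coe (by decide)

/-- Up to order, the only triangles are the edge triples `0, 1, 2` and `0, 3, 4`. -/
theorem range_copy_graphTwo (w : Hom graphD.toHypergraph graphTwo.toHypergraph) :
    Set.range w.toFun = (copyA : Set (Fin 9)) ∨ Set.range w.toFun = (copyB : Set (Fin 9)) := by
  obtain ⟨t, -, ht, hw⟩ := exists_triangle w
  have key : ∀ i j k, IsTriangle edgesTwo i j k →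
      edgesTwo i ∪ edgesTwo j ∪ edgesTwo k = copyA ∨
      edgesTwo i ∪ edgesTwo j ∪ edgesTwo k = copyB := by decide +kernel
  rw [hw]
  exact (key _ _ _ ht).imp (fun h => by rw [h]) (fun h => by rw [h])

theorem copyA_mem :
    (copyA : Set (Fin 9)) ∈ Set.range (representableEndo {graphD} graphTwo).ea :=
  range_homA ▸ copy_mem homA

theorem copyB_mem :
    (copyB : Set (Fin 9)) ∈ Set.range (representableEndo {graphD} graphTwo).ea :=
  range_homB ▸ copy_mem homB

theorem copyA_adj_copyB :
    (labelledLineGraph graphTwo).Adj ⟨_, copyA_mem⟩ ⟨_, copyB_mem⟩ := by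
  refine ⟨⟨fun h => ?_, ?_⟩, ((edgesTwo 0 : Finset (Fin 9)) : Set (Fin 9)), ?_, ?_⟩
  · exact absurd (Finset.coe_injective (congrArg Subtype.val h) : copyA = copyB) (by decide)
  · exact le_encard_coe_inter (N := 3) le_rfl (by decide)
  · refine ⟨homA, range_homA, (0 : Fin 3), ?_⟩
    rw [graphD_ea]
    change _ = ![0, 1, 2, 3, 4, 5] '' _
    rw [← Finset.coe_image]
    exact congrArg _ (by decide)
  · refine ⟨homB, range_homB, (0 : Fin 3), ?_⟩
    rw [graphD_ea]
    change _ = ![0, 7, 8, 3, 4, 6] '' _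
    rw [← Finset.coe_image]
    exact congrArg _ (by decide)

theorem copyA_notMem_gluedScheme : (copyA : Set (Fin 9)) ∉ gluedScheme graphTwo := by
  intro h
  obtain ⟨x, hx⟩ := exists_of_mem_componentUnions h
  have hB : (labelledLineGraph graphTwo).Reachable x ⟨_, copyB_mem⟩ := by
    obtain ⟨w, hw⟩ := exists_copy_of_mem x.2
    rcases range_copy_graphTwo w with h | h
    · obtain rfl : x = ⟨_, copyA_mem⟩ := Subtype.ext (hw.symm.trans h)
      exact copyA_adj_copyB.reachable
    · obtain rfl : x = ⟨_, copyB_mem⟩ := Subtype.ext (hw.symm.trans h)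
      exact .rfl
  have hsub : (copyB : Set (Fin 9)) ⊆ copyA := by
    rw [hx]
    exact Set.subset_iUnion₂_of_subset _ hB subset_rfl
  exact absurd (Finset.coe_subset.1 hsub) (by decide)

/-! ### Two overlapping copies of the previous hypergraph -/

/-- The edges of two copies of `graphTwo` that have six vertices in common. -/
def edgesFour : Fin 10 → Finset (Fin 12) :=
  -- The first row is `edgesTwo`; the second is its image under `homSnd`, with new vertices `9, 10,
  -- 11`. The halves share the vertices `0, 1, 2, 4, 5, 8` but no edge.
  ![{0, 3, 4}, {1, 4, 5}, {2, 3, 5}, {4, 6, 7}, {3, 6, 8},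
    {1, 4, 9}, {5, 9, 10}, {2, 4, 5}, {8, 9, 11}, {0, 4, 11}]

/-- Two copies of `graphTwo` that have six vertices in common. -/
abbrev graphFour : FinHypergraph := ofFinsets edgesFour

/-- The first copy of `graphTwo`. -/
def homFst : Hom graphTwo.toHypergraph graphFour.toHypergraph :=
  homOfFinsets ![0, 1, 2, 3, 4, 5, 6, 7, 8] (by decide) (by decide)

/-- The second copy of `graphTwo`. -/
def homSnd : Hom graphTwo.toHypergraph graphFour.toHypergraph :=
  homOfFinsets ![1, 10, 2, 4, 9, 5, 11, 8, 0] (by decide) (by decide)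

/-- No triangle mixes the two halves. Vertex `3` detects the copies in the first half, and `9` never
lies on one of them. -/
theorem copy_graphFour (w : Hom graphD.toHypergraph graphFour.toHypergraph) :
    ((3 : Fin 12) ∈ Set.range w.toFun ∧ (9 : Fin 12) ∉ Set.range w.toFun ∧
      ∀ d, ∃ i < 5, w.toFun '' graphD.ea d = (edgesFour i : Set (Fin 12))) ∨
    ((3 : Fin 12) ∉ Set.range w.toFun ∧
      ∀ d, ∃ i ≥ 5, w.toFun '' graphD.ea d = (edgesFour i : Set (Fin 12))) := by
  obtain ⟨t, hd, ht, hw⟩ := exists_triangle w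
  have key : ∀ i j k, IsTriangle edgesFour i j k →
      (3 ∈ edgesFour i ∪ edgesFour j ∪ edgesFour k ∧
        9 ∉ edgesFour i ∪ edgesFour j ∪ edgesFour k ∧ i < 5 ∧ j < 5 ∧ k < 5) ∨
      (3 ∉ edgesFour i ∪ edgesFour j ∪ edgesFour k ∧ i ≥ 5 ∧ j ≥ 5 ∧ k ≥ 5) := by
    decide +kernel
  rw [hw]
  rcases key _ _ _ ht with ⟨h3, h9, hi⟩ | ⟨h3, hi⟩
  · have ht : ∀ d, t d < 5 := Fin.forall_fin_succ.2 ⟨hi.1, by simpa [Fin.forall_fin_two] using hi.2⟩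
    exact Or.inl ⟨h3, h9, fun d => ⟨t d, ht d, hd d⟩⟩
  · have ht : ∀ d, t d ≥ 5 := Fin.forall_fin_succ.2 ⟨hi.1, by simpa [Fin.forall_fin_two] using hi.2⟩
    exact Or.inr ⟨h3, fun d => ⟨t d, ht d, hd d⟩⟩

/-- A shared label is a common edge, and the ten edges have distinct vertex sets, so adjacent copies
lie in the same half. -/
theorem three_mem_of_adj {a b : Set.range (representableEndo {graphD} graphFour).ea}
    (h : (labelledLineGraph graphFour).Adj a b) (ha : (3 : Fin 12) ∈ a.1) :
    (3 : Fin 12) ∈ b.1 := by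
  obtain ⟨-, l, ⟨w, hw, d, hl⟩, ⟨w', hw', d', hl'⟩⟩ := h
  rw [← hw] at ha
  rw [← hw']
  rcases copy_graphFour w with ⟨-, -, h⟩ | ⟨h, -⟩
  swap
  · exact (h ha).elim
  rcases copy_graphFour w' with ⟨h', -⟩ | ⟨-, h'⟩
  · exact h'
  obtain ⟨i, hi, he⟩ := h d
  obtain ⟨j, hj, he'⟩ := h' d'
  have hij : edgesFour i = edgesFour j := by
    have : (edgesFour i : Set (Fin 12)) = edgesFour j := by rw [← he, ← he', ← hl, ← hl']
    exact_mod_cast this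
  have hinj : ∀ i j, edgesFour i = edgesFour j → i = j := by decide
  obtain rfl := hinj i j hij
  exact (not_lt_of_ge hj hi).elim

theorem univ_notMem_gluedScheme_graphFour : Set.univ ∉ gluedScheme graphFour := by
  intro h
  obtain ⟨x, hx⟩ := exists_of_mem_componentUnions h
  have hmem : ∀ v : graphFour.V,
      ∃ y, (labelledLineGraph graphFour).Reachable x y ∧ v ∈ y.1 := by
    intro v
    obtain ⟨y, hy, hv⟩ := Set.mem_iUnion₂.1 (hx ▸ Set.mem_univ v)
    exact ⟨y, hy, hv⟩
  obtain ⟨y, hy, h3⟩ := hmem (3 : Fin 12)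
  obtain ⟨z, hz, h9⟩ := hmem (9 : Fin 12)
  have hyz := (SimpleGraph.reachable_iff_reflTransGen _ _).1 (hy.symm.trans hz)
  have h3' : (3 : Fin 12) ∈ z.1 := by
    clear hz h9
    induction hyz with
    | refl => exact h3
    | tail _ hbc ih => exact three_mem_of_adj hbc ih
  obtain ⟨w, hw⟩ := exists_copy_of_mem z.2
  rw [← hw] at h3' h9
  rcases copy_graphFour w with ⟨-, h, -⟩ | ⟨h, -⟩
  · exact h h9
  · exact h h3'

/-! ### Non-representability -/

section Representable

variable {R : Set FinHypergraph} {k : ℕ∞}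

theorem exists_copy_of_mem_gluedScheme {G : FinHypergraph} {p : Set G.V}
    (hp : p ∈ gluedScheme G) {v : G.V} (hv : v ∈ p) :
    ∃ w : Hom graphD.toHypergraph G.toHypergraph, v ∈ Set.range w.toFun := by
  obtain ⟨x, rfl⟩ := exists_of_mem_componentUnions hp
  simp only [Set.mem_iUnion] at hv
  obtain ⟨y, -, hv⟩ := hv
  obtain ⟨w, hw⟩ := exists_copy_of_mem y.2
  exact ⟨w, hw ▸ hv⟩

theorem nonempty_copy_of_mem_gluedScheme {G : FinHypergraph} {p : Set G.V}
    (hp : p ∈ gluedScheme G) : Nonempty (Hom graphD.toHypergraph G.toHypergraph) := by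
  obtain ⟨x, -⟩ := exists_of_mem_componentUnions hp
  exact ⟨(exists_copy_of_mem x.2).choose⟩

/-- The identity of `H` is an edge of `Φ_R(H)` that already covers all vertices. If the two schemes
agree, every member of `R` is therefore covered by copies of `D`. -/
theorem univ_mem_representableScheme {H : FinHypergraph} (hH : H ∈ R) :
    Set.univ ∈ representableScheme R k H := by
  have h : (Set.univ : Set H.V) ∈ Set.range (representableEndo R H).ea := by
    rw [← Set.range_id]
    exact range_mem_representableEndo hH (Hom.id _)
  exact componentUnions_of_forall_reachable ⟨_, h⟩ fun v => ⟨_, .rfl, Set.mem_univ v⟩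

theorem univ_mem_gluedScheme_graphD : Set.univ ∈ gluedScheme graphD := by
  have h : (Set.univ : Set graphD.V) ∈ Set.range (representableEndo {graphD} graphD).ea := by
    rw [← Set.range_id]
    exact copy_mem (Hom.id _)
  exact componentUnions_of_forall_reachable ⟨_, h⟩ fun v => ⟨_, .rfl, Set.mem_univ v⟩

/-- Some `H` in `R` maps to `D`, and `D` maps to `H`. The composite is an injective self-map of six
vertices, so `H → D` is onto and any copy of `D` is also the image of a morphism from `H`. -/
theorem copy_mem_of_eq (hC : gluedScheme = representableScheme R k) {G : FinHypergraph}
    (w : Hom graphD.toHypergraph G.toHypergraph) :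
    Set.range w.toFun ∈ Set.range (representableEndo R G).ea := by
  have h : Set.univ ∈ representableScheme R k graphD := hC ▸ univ_mem_gluedScheme_graphD
  obtain ⟨x, -⟩ := exists_of_mem_componentUnions h
  obtain ⟨H, hH, r, -⟩ := exists_hom_of_mem x.2
  have hH' : Set.univ ∈ gluedScheme H := hC ▸ univ_mem_representableScheme hH
  obtain ⟨u⟩ := nonempty_copy_of_mem_gluedScheme hH'
  have hsurj : Function.Surjective (r.comp u).toFun :=
    (Finite.injective_iff_surjective (α := Fin 6)).1 (r.comp u).injective
  have hr : Set.range r.toFun = Set.univ :=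
    Set.eq_univ_of_forall fun v => (hsurj v).elim fun y hy => ⟨u.toFun y, hy⟩
  have := range_mem_representableEndo hH (w.comp r)
  rwa [Hom.range_comp, hr, Set.image_univ] at this

/-- `H` is covered by copies of `D`, each sent onto `A` or `B`; if both occur, the image contains `A
∪ B`, which is everything. -/
theorem range_hom_graphTwo {H : FinHypergraph} (hH : Set.univ ∈ gluedScheme H)
    (r : Hom H.toHypergraph graphTwo.toHypergraph) :
    Set.range r.toFun = (copyA : Set (Fin 9)) ∨ Set.range r.toFun = (copyB : Set (Fin 9)) ∨
      Set.range r.toFun = Set.univ := by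
  have hcov : ∀ v ∈ Set.range r.toFun, ∃ w : Hom graphD.toHypergraph H.toHypergraph,
      v ∈ Set.range (r.comp w).toFun := by
    rintro _ ⟨v, rfl⟩
    obtain ⟨w, y, rfl⟩ := exists_copy_of_mem_gluedScheme hH (Set.mem_univ v)
    exact ⟨w, y, rfl⟩
  have hsub : ∀ w : Hom graphD.toHypergraph H.toHypergraph,
      Set.range (r.comp w).toFun ⊆ Set.range r.toFun := fun w =>
    Set.range_comp_subset_range w.toFun r.toFun
  obtain ⟨u⟩ := nonempty_copy_of_mem_gluedScheme hH
  by_cases hA : ∀ w : Hom graphD.toHypergraph H.toHypergraph,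
      Set.range (r.comp w).toFun = (copyA : Set (Fin 9))
  · left
    refine Set.Subset.antisymm (fun v hv => ?_) (hA u ▸ hsub u)
    obtain ⟨w, hw⟩ := hcov v hv
    exact hA w ▸ hw
  by_cases hB : ∀ w : Hom graphD.toHypergraph H.toHypergraph,
      Set.range (r.comp w).toFun = (copyB : Set (Fin 9))
  · right; left
    refine Set.Subset.antisymm (fun v hv => ?_) (hB u ▸ hsub u)
    obtain ⟨w, hw⟩ := hcov v hv
    exact hB w ▸ hw
  right; right
  push Not at hA hB
  obtain ⟨w, hw⟩ := hA
  obtain ⟨w', hw'⟩ := hB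
  have h := hsub w
  have h' := hsub w'
  -- The copy `w` is sent onto `B` because its image is not `A`; likewise `w'` is sent onto `A`.
  rw [(range_copy_graphTwo _).resolve_left hw] at h
  rw [(range_copy_graphTwo _).resolve_right hw'] at h'
  refine Set.eq_univ_of_forall fun (v : Fin 9) => ?_
  have hv : v ∈ copyA ∨ v ∈ copyB := by revert v; decide
  exact hv.elim (fun hv => h' hv) (fun hv => h hv)

theorem le_three_or_exists_surjective (hC : gluedScheme = representableScheme R k) :
    k ≤ (3 : ℕ) ∨ k ≤ (6 : ℕ) ∧ ∃ H ∈ R, ∃ r : Hom H.toHypergraph graphTwo.toHypergraph,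
      Set.range r.toFun = Set.univ := by
  have hA : (copyA : Set (Fin 9)) ∈ Set.range (representableEndo R graphTwo).ea :=
    range_homA ▸ copy_mem_of_eq hC homA
  have hnot : (copyA : Set (Fin 9)) ∉ representableScheme R k graphTwo :=
    hC ▸ copyA_notMem_gluedScheme
  have : ∃ x, (lineGraph k (representableEndo R graphTwo)).Adj ⟨_, hA⟩ x := by
    by_contra! h
    exact hnot (componentUnions_of_isolated ⟨_, hA⟩ h)
  obtain ⟨⟨x, hx⟩, hne, hk⟩ := this
  obtain ⟨H, hH, r, rfl⟩ := exists_hom_of_mem hx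
  have hH' : Set.univ ∈ gluedScheme H := hC ▸ univ_mem_representableScheme hH
  rcases range_hom_graphTwo hH' r with h | h | h
  · exact (hne (Subtype.ext h.symm)).elim
  · left
    refine le_of_le_encard_coe_inter (s := copyA) (t := copyB) ?_ (by decide)
    rw [← h]
    exact hk
  · right
    refine ⟨le_of_le_encard_coe_inter (s := copyA) (t := copyA) ?_ (by decide), H, hH, r, h⟩
    rw [Set.inter_self]
    exact hk.trans (Set.encard_le_encard Set.inter_subset_left)

theorem lineGraph_adj_coe {n m : ℕ} {F : Fin m → Finset (Fin n)} {s t : Finset (Fin n)}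
    (hs : (s : Set (Fin n)) ∈ Set.range (representableEndo R (ofFinsets F)).ea)
    (ht : (t : Set (Fin n)) ∈ Set.range (representableEndo R (ofFinsets F)).ea)
    (hne : s ≠ t) {N : ℕ} (hk : k ≤ N) (h : N ≤ (s ∩ t).card) :
    (lineGraph k (representableEndo R (ofFinsets F))).Adj ⟨_, hs⟩ ⟨_, ht⟩ :=
  ⟨fun h => hne (Finset.coe_injective (congrArg Subtype.val h)), le_encard_coe_inter hk h⟩

/-- The four copies of `D` form a path `B, A, A', B'` whose consecutive members meet in `3`, `4` and
`3` vertices. -/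
theorem univ_mem_graphFour_of_le_three (hk : k ≤ (3 : ℕ))
    (hD : ∀ w : Hom graphD.toHypergraph graphFour.toHypergraph,
      Set.range w.toFun ∈ Set.range (representableEndo R graphFour).ea) :
    Set.univ ∈ representableScheme R k graphFour := by
  have hA : (({0, 1, 2, 3, 4, 5} : Finset (Fin 12)) : Set (Fin 12)) ∈
      Set.range (representableEndo R graphFour).ea :=
    coe_mem_of_range_mem (hD (homFst.comp homA)) (by decide)
  have hB : (({0, 3, 4, 6, 7, 8} : Finset (Fin 12)) : Set (Fin 12)) ∈
      Set.range (representableEndo R graphFour).ea :=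
    coe_mem_of_range_mem (hD (homFst.comp homB)) (by decide)
  have hA' : (({1, 2, 4, 5, 9, 10} : Finset (Fin 12)) : Set (Fin 12)) ∈
      Set.range (representableEndo R graphFour).ea :=
    coe_mem_of_range_mem (hD (homSnd.comp homA)) (by decide)
  have hB' : (({0, 1, 4, 8, 9, 11} : Finset (Fin 12)) : Set (Fin 12)) ∈
      Set.range (representableEndo R graphFour).ea :=
    coe_mem_of_range_mem (hD (homSnd.comp homB)) (by decide)
  have hAB := (lineGraph_adj_coe hA hB (by decide) hk (by decide)).reachable
  have hAA' := (lineGraph_adj_coe hA hA' (by decide) hk (by decide)).reachable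
  have hAB' := hAA'.trans (lineGraph_adj_coe hA' hB' (by decide) hk (by decide)).reachable
  refine componentUnions_of_forall_reachable ⟨_, hA⟩ fun (v : Fin 12) => ?_
  have hv : v ∈ ({0, 1, 2, 3, 4, 5} : Finset (Fin 12)) ∨
      v ∈ ({0, 3, 4, 6, 7, 8} : Finset (Fin 12)) ∨
      v ∈ ({1, 2, 4, 5, 9, 10} : Finset (Fin 12)) ∨
      v ∈ ({0, 1, 4, 8, 9, 11} : Finset (Fin 12)) := by
    revert v; decide
  rcases hv with hv | hv | hv | hv
  · exact ⟨_, .rfl, hv⟩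
  · exact ⟨_, hAB, hv⟩
  · exact ⟨_, hAA', hv⟩
  · exact ⟨_, hAB', hv⟩

theorem univ_mem_graphFour_of_le_six (hk : k ≤ (6 : ℕ)) {H : FinHypergraph} (hH : H ∈ R)
    (r : Hom H.toHypergraph graphTwo.toHypergraph) (hr : Set.range r.toFun = Set.univ) :
    Set.univ ∈ representableScheme R k graphFour := by
  have hmem : ∀ f : Hom graphTwo.toHypergraph graphFour.toHypergraph,
      Set.range f.toFun ∈ Set.range (representableEndo R graphFour).ea := by
    intro f
    have := range_mem_representableEndo hH (f.comp r)
    rwa [Hom.range_comp, hr, Set.image_univ] at this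
  have h₁ : (({0, 1, 2, 3, 4, 5, 6, 7, 8} : Finset (Fin 12)) : Set (Fin 12)) ∈
      Set.range (representableEndo R graphFour).ea :=
    coe_mem_of_range_mem (hmem homFst) (by decide)
  have h₂ : (({0, 1, 2, 4, 5, 8, 9, 10, 11} : Finset (Fin 12)) : Set (Fin 12)) ∈
      Set.range (representableEndo R graphFour).ea :=
    coe_mem_of_range_mem (hmem homSnd) (by decide)
  have h₁₂ := (lineGraph_adj_coe h₁ h₂ (by decide) hk (by decide)).reachable
  refine componentUnions_of_forall_reachable ⟨_, h₁⟩ fun (v : Fin 12) => ?_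
  have hv : v ∈ ({0, 1, 2, 3, 4, 5, 6, 7, 8} : Finset (Fin 12)) ∨
      v ∈ ({0, 1, 2, 4, 5, 8, 9, 10, 11} : Finset (Fin 12)) := by
    revert v; decide
  rcases hv with hv | hv
  · exact ⟨_, .rfl, hv⟩
  · exact ⟨_, h₁₂, hv⟩

theorem gluedScheme_not_isRepresentable : ¬ gluedScheme.IsRepresentable := by
  rintro ⟨R, k, -, hC⟩
  refine univ_notMem_gluedScheme_graphFour ?_
  rw [hC]
  rcases le_three_or_exists_surjective hC with hk | ⟨hk, H, hH, r, hr⟩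
  · exact univ_mem_graphFour_of_le_three hk fun w => copy_mem_of_eq hC w
  · exact univ_mem_graphFour_of_le_six hk hH r hr

end Representable

end OverlapClust

theorem mainTheorem4 :
    OverlapClust.gluedScheme.IsExcisive ∧
    OverlapClust.gluedScheme.IsFunctorial ∧
    ¬ OverlapClust.gluedScheme.IsRepresentable :=
  ⟨OverlapClust.gluedScheme_isExcisive, OverlapClust.gluedScheme_isFunctorial,
    OverlapClust.gluedScheme_not_isRepresentable⟩
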